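/- Let $\alpha>0$ and $\beta<1+\alpha$ be real numbers. For $z\in\mathbb{C}\setminus\{0\}$ put $$F_{\alpha,\beta}(z):=\frac{1}{\pi\alpha}\,\mathrm{p.v.}\!\int_0^\infty \tau^{\frac{1-\beta}{\alpha}}e^{-\tau^{1/\alpha}}\,\frac{\tau\sin(\pi\beta)-z\sin(\pi(\beta-\alpha))}{\tau^2-2\tau z\cos(\pi\alpha)+z^2}\,d\tau ,$$ where $\mathrm{p.v.}\int_0^\infty$ denotes $\lim_{\varepsilon\to0^+}\int_{\{\tau>0:\,|\tau-|z||>\varepsilon\}}$, which is the ordinary integral whenever that one converges absolutely. Then for every real $z<0$ this principal value exists (the truncated integrals being absolutely convergent), and the integral over $(0,\infty)$ converges absolutely if $\alpha$ is not an odd integer; the function $z\mapsto F_{\alpha,\beta}(z)$ of the real variable $z$ is $C^\infty$ on $(-\infty,0)$; and for every integer $k\ge 0$ there is a constant $C>0$, depending only on $\alpha,\beta,k$, such that for all real $z<0$ $$\left|F^{(k)}_{\alpha,\beta}(z)\right|\le C\,|z|^{-\frac{(\beta-1)_+}{\alpha}-k}\begin{cases}(1+|z|)^{-1+\frac{(\beta-1)_+}{\alpha}}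 & \text{if }\alpha\ne\beta,\\ (1+|z|)^{-2+\frac{(\beta-1)_+}{\alpha}} & \text{if }\alpha=\beta,\end{cases}$$ where $F^{(k)}_{\alpha,\beta}$ is the $k$-th derivative with respect to the real variable $z$ and $(x)_+=\max(x,0)$. -/

import Mathlib

open Filter Topology MeasureTheory Set
open scoped ContDiff

noncomputable section

/-- The half-line `(0, ∞)` with the closed interval of radius `ε` around `c` cut out. -/
def puncturedRay (c ε : ℝ) : Set ℝ := {τ : ℝ | 0 < τ ∧ ε < |τ - c|}

/-- The Cauchy principal value at the point `c` of the integral of `f` over `(0, ∞)`: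
the limit, as `ε → 0+`, of the integrals over `{τ > 0 : |τ - c| > ε}`. -/
def principalValue (f : ℝ → ℂ) (c : ℝ) : ℂ :=
  limUnder (𝓝[>] (0 : ℝ)) fun ε : ℝ => ∫ τ in puncturedRay c ε, f τ

/-- Where the integral converges absolutely, its principal value is the integral. -/
theorem principalValue_eq_integral (f : ℝ → ℂ) (c : ℝ) (hf : IntegrableOn f (Ioi 0)) :
    principalValue f c = ∫ τ in Ioi (0 : ℝ), f τ := by
  have hm : ∀ ε, MeasurableSet (puncturedRay c ε) := fun ε =>
    (measurableSet_lt measurable_const measurable_id).inter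
      (measurableSet_lt measurable_const (measurable_id.sub_const c).abs)
  have hfi : Integrable ((Ioi (0 : ℝ)).indicator f) := hf.integrable_indicator measurableSet_Ioi
  apply Tendsto.limUnder_eq
  rw [← integral_indicator measurableSet_Ioi]
  have he : ∀ ε, (puncturedRay c ε).indicator f
      = (puncturedRay c ε).indicator ((Ioi (0 : ℝ)).indicator f) := by
    intro ε
    rw [indicator_indicator]
    congr 1
    ext τ
    simp only [puncturedRay, mem_inter_iff, mem_Ioi, mem_ofPred_eq]
    tauto
  simp_rw [← fun ε => integral_indicator (f := f) (μ := volume) (hm ε), he]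
  refine tendsto_integral_filter_of_dominated_convergence
    (fun τ => ‖(Ioi (0 : ℝ)).indicator f τ‖) ?_ ?_ hfi.norm ?_
  · exact Eventually.of_forall fun ε => (hfi.indicator (hm ε)).aestronglyMeasurable
  · exact Eventually.of_forall fun ε => Eventually.of_forall fun τ => norm_indicator_le_norm_self _ _
  · have hc : ∀ᵐ τ : ℝ, τ ≠ c := by simp [ae_iff]
    filter_upwards [hc] with τ hτ
    refine tendsto_const_nhds.congr' ?_
    have hpos : 0 < |τ - c| := abs_pos.2 (sub_ne_zero.2 hτ)
    filter_upwards [mem_nhdsWithin_of_mem_nhds (Iio_mem_nhds hpos)] with ε hε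
    by_cases h0 : 0 < τ
    · have hmem : τ ∈ puncturedRay c ε := ⟨h0, hε⟩
      rw [indicator_of_mem hmem]
    · have h1 : τ ∉ Ioi (0 : ℝ) := h0
      have h2 : τ ∉ puncturedRay c ε := fun h => h0 h.1
      rw [indicator_of_notMem h1, indicator_of_notMem h2]

/-- The integrand
`τ^((1-β)/α) e^(-τ^(1/α)) (τ sin(πβ) - z sin(π(β-α))) / (τ² - 2 τ z cos(πα) + z²)`. -/
def popovIntegrand (α β : ℝ) (z : ℂ) (τ : ℝ) : ℂ :=
  ((τ ^ ((1 - β) / α) * Real.exp (-τ ^ (1 / α)) : ℝ) : ℂ) *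
    (((τ : ℂ) * (Real.sin (Real.pi * β) : ℂ) - z * (Real.sin (Real.pi * (β - α)) : ℂ)) /
      ((τ : ℂ) ^ 2 - 2 * (τ : ℂ) * z * (Real.cos (Real.pi * α) : ℂ) + z ^ 2))

/-- The Popov integral `F_{α,β}(z)`. The roots of the denominator are `z e^{±iπα}`, so the only
possible singularity on `(0, ∞)` is `τ = |z|`, and the integral is a principal value there. -/
def popovF (α β : ℝ) (z : ℂ) : ℂ :=
  ((1 / (Real.pi * α) : ℝ) : ℂ) * principalValue (popovIntegrand α β z) ‖z‖

end

/-! Put z = -x and τ = xs. The integral becomes p.v. ∫ g(xs) q(s) ds with g(t) = t^a e^(-t^(1/α)), a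
= (1-β)/α > -1 and a kernel q = `popovKernel` free of x. So x d/dx acts only on g, as t d/dt, and
all iterates (t d/dt)^k g obey one bound C·`decayWeight a`. Every Euler derivative of F is thus an
integral of the same type, and one size estimate serves for all k.

The denominator of q vanishes on (0, ∞) only if α is an odd integer, and then q(s) = sin(πβ)/(s-1).
This is odd about 1, so subtracting g(x)q(s) on a symmetric neighbourhood N of 1 leaves the
principal value unchanged and makes the integral absolutely convergent
(`EulerFamily.abs_regularized_le`).

The size comes from ∫ w(xs) κ(s) ds, where w is the weight and κ dominates q off N
(`exists_integral_le_popovModulus`). For large x the order of q at s = 0 decides: x^(-1) in general,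
x^(-2) if α = β, since then sin π(β-α) = 0. For small x the integral stays bounded if β < 1, and is
of order x^a = x^(-(β-1)/α) if β ≥ 1. Finally z^k (d/dz)^k is a polynomial in θ = z d/dz, which
turns these bounds into bounds for F^(k). -/

/-! ### The weight and its integrals -/

/-- The majorant `t^a (1+t)^(-(a+4))`: of order `t^a` at `0` and `t^(-4)` at infinity. -/
noncomputable def decayWeight (a t : ℝ) : ℝ := t ^ a * (1 + t) ^ (-(a + 4))

theorem decayWeight_nonneg (a : ℝ) {t : ℝ} (ht : 0 < t) : 0 ≤ decayWeight a t := by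
  unfold decayWeight; positivity

theorem measurable_decayWeight (a : ℝ) : Measurable (decayWeight a) := by
  unfold decayWeight; fun_prop

theorem decayWeight_le_rpow {a t : ℝ} (ha : -1 < a) (ht : 0 < t) : decayWeight a t ≤ t ^ a := by
  unfold decayWeight
  exact mul_le_of_le_one_right (by positivity)
    (Real.rpow_le_one_of_one_le_of_nonpos (by linarith) (by linarith))

theorem decayWeight_le_rpow_neg_four {a t : ℝ} (ha : -1 < a) (ht : 0 < t) :
    decayWeight a t ≤ t ^ (-4 : ℝ) := by
  unfold decayWeight
  calc t ^ a * (1 + t) ^ (-(a + 4)) ≤ t ^ a * t ^ (-(a + 4)) := by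
        gcongr ?_ * ?_
        exact Real.rpow_le_rpow_of_nonpos ht (by linarith) (by linarith)
    _ = t ^ (-4 : ℝ) := by rw [← Real.rpow_add ht]; ring_nf

/-- The weight changes by a bounded factor when its argument does. -/
theorem decayWeight_mul_le {a l t : ℝ} (ha : -1 < a) (hl : 1 / 2 ≤ l) (hl' : l ≤ 2)
    (ht : 0 < t) : decayWeight a (l * t) ≤ 2 ^ |a| * 2 ^ (a + 4) * decayWeight a t := by
  have hl0 : 0 < l := by linarith
  have h1 : l ^ a ≤ 2 ^ |a| := by
    rcases le_total 0 a with h | h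
    · rw [abs_of_nonneg h]; exact Real.rpow_le_rpow hl0.le hl' h
    · rw [abs_of_nonpos h]
      calc l ^ a ≤ (1 / 2) ^ a := Real.rpow_le_rpow_of_nonpos (by norm_num) hl h
        _ = 2 ^ (-a) := by
          rw [one_div, Real.inv_rpow (by norm_num), Real.rpow_neg (by norm_num)]
  have h2 : (1 + l * t) ^ (-(a + 4)) ≤ 2 ^ (a + 4) * (1 + t) ^ (-(a + 4)) := by
    calc (1 + l * t) ^ (-(a + 4)) ≤ ((1 / 2) * (1 + t)) ^ (-(a + 4)) :=
          Real.rpow_le_rpow_of_nonpos (by positivity) (by nlinarith) (by linarith)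
      _ = 2 ^ (a + 4) * (1 + t) ^ (-(a + 4)) := by
          rw [Real.mul_rpow (by norm_num) (by positivity), one_div,
            Real.inv_rpow (by norm_num), Real.rpow_neg (by norm_num : (0 : ℝ) ≤ 2), inv_inv]
  unfold decayWeight
  rw [Real.mul_rpow hl0.le ht.le]
  calc l ^ a * t ^ a * (1 + l * t) ^ (-(a + 4))
      ≤ 2 ^ |a| * t ^ a * (2 ^ (a + 4) * (1 + t) ^ (-(a + 4))) := by gcongr
    _ = _ := by ring

/-- A function on the half-line bounded by one integrable power near `0` and by another one
near infinity is integrable. -/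
theorem integrableOn_Ioi_of_le_rpow {f : ℝ → ℝ} (hf : Measurable f) {p r : ℝ} (hp : -1 < p)
    (hr : r < -1) (h0 : ∀ t, 0 < t → |f t| ≤ t ^ p) (h1 : ∀ t, 0 < t → |f t| ≤ t ^ r) :
    IntegrableOn f (Ioi 0) := by
  rw [← Ioc_union_Ioi_eq_Ioi zero_le_one]
  refine IntegrableOn.union ?_ ?_
  · have hi : IntegrableOn (fun t : ℝ => t ^ p) (Ioc 0 1) :=
      (intervalIntegrable_iff_integrableOn_Ioc_of_le zero_le_one).1
        (intervalIntegral.intervalIntegrable_rpow' hp)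
    refine hi.mono' hf.aestronglyMeasurable ?_
    filter_upwards [ae_restrict_mem measurableSet_Ioc] with t ht using h0 t ht.1
  · have hi : IntegrableOn (fun t : ℝ => t ^ r) (Ioi 1) := integrableOn_Ioi_rpow_of_lt hr one_pos
    refine hi.mono' hf.aestronglyMeasurable ?_
    filter_upwards [ae_restrict_mem measurableSet_Ioi] with t ht using h1 t (one_pos.trans ht)

theorem integrableOn_decayWeight_mul_rpow {a p : ℝ} (ha : -1 < a) (hp : -1 < a + p)
    (hp' : p < 3) : IntegrableOn (fun t => decayWeight a t * t ^ p) (Ioi 0) := by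
  refine integrableOn_Ioi_of_le_rpow ((measurable_decayWeight a).mul (by fun_prop)) hp
    (r := p - 4) (by linarith) ?_ ?_
  · intro t ht
    rw [abs_of_nonneg (mul_nonneg (decayWeight_nonneg a ht) (by positivity)), Real.rpow_add ht]
    gcongr
    exact decayWeight_le_rpow ha ht
  · intro t ht
    rw [abs_of_nonneg (mul_nonneg (decayWeight_nonneg a ht) (by positivity)),
      show p - 4 = -4 + p by ring, Real.rpow_add ht]
    gcongr
    exact decayWeight_le_rpow_neg_four ha ht

theorem decayWeight_dilate_mul_rpow (a p : ℝ) {x s : ℝ} (hx : 0 < x) (hs : 0 < s) :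
    decayWeight a (x * s) * s ^ p = x ^ (-p) * (decayWeight a (x * s) * (x * s) ^ p) := by
  rw [Real.mul_rpow hx.le hs.le, Real.rpow_neg hx.le]
  have : x ^ p ≠ 0 := by positivity
  field_simp

theorem integrableOn_decayWeight_dilate {a p x : ℝ} (ha : -1 < a) (hp : -1 < a + p)
    (hp' : p < 3) (hx : 0 < x) :
    IntegrableOn (fun s => decayWeight a (x * s) * s ^ p) (Ioi 0) := by
  have h := (integrableOn_Ioi_comp_mul_left_iff (fun t => decayWeight a t * t ^ p) 0 hx).2
    (by simpa using integrableOn_decayWeight_mul_rpow ha hp hp')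
  refine IntegrableOn.congr_fun (h.const_mul (x ^ (-p))) ?_ measurableSet_Ioi
  intro s hs
  exact (decayWeight_dilate_mul_rpow a p hx hs).symm

theorem integral_decayWeight_dilate (a p : ℝ) {x : ℝ} (hx : 0 < x) :
    ∫ s in Ioi (0 : ℝ), decayWeight a (x * s) * s ^ p =
      x ^ (-p - 1) * ∫ t in Ioi (0 : ℝ), decayWeight a t * t ^ p := by
  rw [setIntegral_congr_fun measurableSet_Ioi
    (fun s hs => decayWeight_dilate_mul_rpow a p hx hs), integral_const_mul,
    integral_comp_mul_left_Ioi (fun t => decayWeight a t * t ^ p) 0 hx, Real.rpow_sub hx,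
    Real.rpow_one, mul_zero, smul_eq_mul]
  ring

/-! ### Iterates of the Euler operator -/

/-- A sequence of functions on the half-line, each the image of the previous one under the Euler
operator `t d/dt`, and each dominated by `decayWeight a`. -/
structure EulerFamily (a : ℝ) (G : ℕ → ℝ → ℝ) : Prop where
  hasDerivAt : ∀ k t, 0 < t → HasDerivAt (G k) (G (k + 1) t / t) t
  bound : ∀ k, ∃ C, 0 ≤ C ∧ ∀ t, 0 < t → |G k t| ≤ C * decayWeight a t

/-- The functions obtained from `t^(a+m/α) e^(-t^(1/α))` by `k` applications of `t d/dt`. -/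
noncomputable def eulerIterate (α a : ℝ) : ℕ → ℕ → ℝ → ℝ
  | 0, m, t => t ^ (a + m / α) * Real.exp (-t ^ (1 / α))
  | k + 1, m, t => (a + m / α) * eulerIterate α a k m t - 1 / α * eulerIterate α a k (m + 1) t

/-- Differentiating the exponential produces a factor t^(1/α), which the second index m records. The
recursion is therefore linear in the family over m, and the induction must run over all m. -/
theorem hasDerivAt_eulerIterate (α a : ℝ) (k m : ℕ) {t : ℝ} (ht : 0 < t) :
    HasDerivAt (eulerIterate α a k m) (eulerIterate α a (k + 1) m t / t) t := by
  induction k generalizing m with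
  | zero =>
    have h1 := Real.hasDerivAt_rpow_const (p := a + m / α) (Or.inl ht.ne')
    have h2 := (Real.hasDerivAt_rpow_const (p := 1 / α) (Or.inl ht.ne')).neg.exp
    have h3 := h1.mul h2
    refine h3.congr_deriv ?_
    simp only [eulerIterate]
    rw [show a + ((m + 1 : ℕ) : ℝ) / α = (a + m / α) + 1 / α by push_cast; ring,
      Real.rpow_add ht (a + m / α), Real.rpow_sub_one ht.ne', Real.rpow_sub_one ht.ne']
    simp only [Pi.neg_apply]
    field_simp
    ring
  | succ k ih =>
    refine (((ih m).const_mul (a + m / α)).sub ((ih (m + 1)).const_mul (1 / α))).congr_deriv ?_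
    simp only [eulerIterate]
    ring

theorem exists_rpow_mul_exp_neg_le (N : ℝ) :
    ∃ C, 0 ≤ C ∧ ∀ u : ℝ, 0 ≤ u → (1 + u) ^ N * Real.exp (-u) ≤ C := by
  obtain ⟨n, hn⟩ := exists_nat_ge N
  -- From (1+u)^n / n! ≤ e^(1+u).
  refine ⟨n.factorial * Real.exp 1, by positivity, fun u hu => ?_⟩
  have h1 : (1 + u) ^ N ≤ (1 + u) ^ n := by
    rw [← Real.rpow_natCast]; exact Real.rpow_le_rpow_of_exponent_le (by linarith) hn
  have h2 : (1 + u) ^ n ≤ n.factorial * Real.exp (1 + u) := by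
    have := Real.pow_div_factorial_le_exp (1 + u) (by linarith) n
    rw [div_le_iff₀ (by positivity)] at this
    linarith
  calc (1 + u) ^ N * Real.exp (-u) ≤ n.factorial * Real.exp (1 + u) * Real.exp (-u) := by
        gcongr; exact h1.trans h2
    _ = n.factorial * Real.exp 1 := by
        rw [mul_assoc, ← Real.exp_add]; ring_nf

/-- In the variable u = t^(1/α) the extra factor t^(m/α) is u^m, and e^(-u) absorbs it along with (1
+ u^α)^(a+4). -/
theorem eulerIterate_bound {α a : ℝ} (hα : 0 < α) (ha : -1 < a) (k m : ℕ) :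
    ∃ C, 0 ≤ C ∧ ∀ t, 0 < t → |eulerIterate α a k m t| ≤ C * decayWeight a t := by
  induction k generalizing m with
  | zero =>
    obtain ⟨C, hC, h⟩ := exists_rpow_mul_exp_neg_le (α * (a + 4) + m)
    refine ⟨2 ^ (a + 4) * C, by positivity, fun t ht => ?_⟩
    obtain ⟨u, hu, rfl⟩ : ∃ u : ℝ, 0 < u ∧ u ^ α = t :=
      ⟨t ^ (1 / α), by positivity, by rw [← Real.rpow_mul ht.le]; simp [hα.ne']⟩
    have hu1 : (u ^ α) ^ (1 / α) = u := by
      rw [← Real.rpow_mul hu.le, mul_one_div_cancel hα.ne', Real.rpow_one]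
    have hum : (u ^ α) ^ ((m : ℝ) / α) = u ^ (m : ℝ) := by
      rw [← Real.rpow_mul hu.le, mul_div_cancel₀ _ hα.ne']
    have hb : (1 + u ^ α) ^ (a + 4) ≤ 2 ^ (a + 4) * (1 + u) ^ (α * (a + 4)) := by
      have h3 : 1 + u ^ α ≤ 2 * (1 + u) ^ α := by
        have := Real.one_le_rpow (show 1 ≤ 1 + u by linarith) hα.le
        have := Real.rpow_le_rpow hu.le (show u ≤ 1 + u by linarith) hα.le
        linarith
      calc (1 + u ^ α) ^ (a + 4) ≤ (2 * (1 + u) ^ α) ^ (a + 4) :=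
            Real.rpow_le_rpow (by positivity) h3 (by linarith)
        _ = _ := by
          rw [Real.mul_rpow (by norm_num) (by positivity), ← Real.rpow_mul (by positivity)]
    have key : u ^ (m : ℝ) * Real.exp (-u) ≤
        2 ^ (a + 4) * C * (1 + u ^ α) ^ (-(a + 4)) := by
      rw [Real.rpow_neg (by positivity), ← div_eq_mul_inv, le_div_iff₀ (by positivity)]
      calc u ^ (m : ℝ) * Real.exp (-u) * (1 + u ^ α) ^ (a + 4)
          ≤ (1 + u) ^ (m : ℝ) * Real.exp (-u) * (2 ^ (a + 4) * (1 + u) ^ (α * (a + 4))) := by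
            gcongr; linarith
        _ = 2 ^ (a + 4) * ((1 + u) ^ (α * (a + 4) + m) * Real.exp (-u)) := by
            rw [Real.rpow_add (show 0 < 1 + u by positivity)]; ring
        _ ≤ 2 ^ (a + 4) * C := by gcongr; exact h u hu.le
    simp only [eulerIterate, decayWeight]
    rw [abs_of_nonneg (by positivity), hu1, Real.rpow_add (by positivity), hum]
    calc (u ^ α) ^ a * u ^ (m : ℝ) * Real.exp (-u)
        = (u ^ α) ^ a * (u ^ (m : ℝ) * Real.exp (-u)) := by ring
      _ ≤ (u ^ α) ^ a * (2 ^ (a + 4) * C * (1 + u ^ α) ^ (-(a + 4))) := by gcongr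
      _ = _ := by ring
  | succ k ih =>
    obtain ⟨C, hC, h⟩ := ih m
    obtain ⟨D, hD, h'⟩ := ih (m + 1)
    refine ⟨|a + m / α| * C + |1 / α| * D, by positivity, fun t ht => ?_⟩
    simp only [eulerIterate]
    calc _ ≤ |(a + m / α) * eulerIterate α a k m t| + |1 / α * eulerIterate α a k (m + 1) t| :=
          abs_sub _ _
      _ ≤ |a + m / α| * (C * decayWeight a t) + |1 / α| * (D * decayWeight a t) := by
          rw [abs_mul, abs_mul]
          gcongr
          · exact h t ht
          · exact h' t ht
      _ = _ := by ring

theorem eulerFamily_eulerIterate {α a : ℝ} (hα : 0 < α) (ha : -1 < a) :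
    EulerFamily a fun k => eulerIterate α a k 0 :=
  ⟨fun k _ ht => hasDerivAt_eulerIterate α a k 0 ht, fun k => eulerIterate_bound hα ha k 0⟩

/-! ### Principal values by subtraction at the pole -/

theorem measurableSet_puncturedRay (c ε : ℝ) : MeasurableSet (puncturedRay c ε) :=
  (measurableSet_lt measurable_const measurable_id).inter
    (measurableSet_lt measurable_const (measurable_id.sub_const c).abs)

theorem puncturedRay_subset_Ioi (c ε : ℝ) : puncturedRay c ε ⊆ Ioi 0 := fun _ h => h.1

/-- Where the integral converges absolutely, the truncated integrals converge to it. -/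
theorem tendsto_integral_puncturedRay {f : ℝ → ℝ} (c : ℝ) (hf : IntegrableOn f (Ioi 0)) :
    Tendsto (fun ε => ∫ τ in puncturedRay c ε, f τ) (𝓝[>] 0) (𝓝 (∫ τ in Ioi (0 : ℝ), f τ)) := by
  have hm := measurableSet_puncturedRay c
  have he : ∀ ε, ∫ τ in puncturedRay c ε, f τ =
      ∫ τ in Ioi (0 : ℝ), (puncturedRay c ε).indicator f τ := fun ε => by
    rw [setIntegral_indicator (hm ε), inter_eq_right.2 (puncturedRay_subset_Ioi c ε)]
  simp_rw [he]
  refine tendsto_integral_filter_of_dominated_convergence (fun τ => ‖f τ‖)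
    (Eventually.of_forall fun ε => (hf.indicator (hm ε)).aestronglyMeasurable)
    (Eventually.of_forall fun ε => Eventually.of_forall fun τ => norm_indicator_le_norm_self _ _)
    hf.norm ?_
  have hc : ∀ᵐ τ ∂(volume.restrict (Ioi (0 : ℝ))), τ ≠ c := by
    refine ae_restrict_of_ae ?_
    simp [ae_iff]
  filter_upwards [hc, ae_restrict_mem measurableSet_Ioi] with τ hτ h0
  refine tendsto_const_nhds.congr' ?_
  have hpos : 0 < |τ - c| := abs_pos.2 (sub_ne_zero.2 hτ)
  filter_upwards [mem_nhdsWithin_of_mem_nhds (Iio_mem_nhds hpos)] with ε hε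
  have hmem : τ ∈ puncturedRay c ε := ⟨h0, hε⟩
  rw [indicator_of_mem hmem]

/-- A kernel on the half-line with at most a simple pole at `1`: it is dominated by `κ` off a
neighbourhood `N` of the pole, and on `N` its truncated integrals cancel. -/
structure PoleKernel (q κ : ℝ → ℝ) (N : Set ℝ) (K : ℝ) : Prop where
  measurable : Measurable q
  measurableSet : MeasurableSet N
  subset_ball : N ⊆ Metric.ball 1 (1 / 2)
  nonneg : 0 ≤ K
  le_of_notMem : ∀ s, 0 < s → s ∉ N → |q s| ≤ K * κ s
  mul_le_of_mem : ∀ s ∈ N, |q s| * |s - 1| ≤ K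
  integral_eq_zero : ∀ δ, 0 < δ → ∫ s in puncturedRay 1 δ, N.indicator q s = 0

/-- The integrand `g(xs) q(s)` with the singular part at the pole subtracted. -/
noncomputable def regularized (q : ℝ → ℝ) (N : Set ℝ) (g : ℝ → ℝ) (x s : ℝ) : ℝ :=
  g (x * s) * q s - g x * N.indicator q s

theorem EulerFamily.aestronglyMeasurable_regularized {a : ℝ} {G : ℕ → ℝ → ℝ}
    (hG : EulerFamily a G) {q κ : ℝ → ℝ} {N : Set ℝ} {K : ℝ} (hq : PoleKernel q κ N K) (k : ℕ)
    {x : ℝ} (hx : 0 < x) :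
    AEStronglyMeasurable (regularized q N (G k) x) (volume.restrict (Ioi 0)) := by
  unfold regularized
  refine AEStronglyMeasurable.sub (AEStronglyMeasurable.mul ?_ hq.measurable.aestronglyMeasurable)
    (((hq.measurable.indicator hq.measurableSet).const_mul _).aestronglyMeasurable)
  refine ContinuousOn.aestronglyMeasurable ?_ measurableSet_Ioi
  intro s hs
  have h1 : ContinuousAt (G k) (x * s) := (hG.hasDerivAt k _ (mul_pos hx hs)).continuousAt
  exact (ContinuousAt.comp (f := fun s => x * s) h1 (by fun_prop)).continuousWithinAt

/-- Off N the bounds on the two factors multiply. On N the mean value inequality with derivative G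
(k+1) t / t gives a factor x|s-1|, which cancels the simple pole of q. -/
theorem EulerFamily.abs_regularized_le {a : ℝ} (ha : -1 < a) {G : ℕ → ℝ → ℝ}
    (hG : EulerFamily a G) {q κ : ℝ → ℝ} {N : Set ℝ} {K : ℝ} (hq : PoleKernel q κ N K) (k : ℕ) :
    ∃ B, 0 ≤ B ∧ ∀ x s, 0 < x → 0 < s → |regularized q N (G k) x s| ≤
      B * (decayWeight a (x * s) * |κ s| + N.indicator 1 s * decayWeight a x) := by
  obtain ⟨C, hC, h⟩ := hG.bound k
  obtain ⟨C', hC', h'⟩ := hG.bound (k + 1)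
  set D : ℝ := 2 ^ |a| * 2 ^ (a + 4) with hD
  have hD0 : 0 ≤ D := by positivity
  have hK := hq.nonneg
  -- The first term serves off N. In the second, serving on N, 2 comes from 1/t ≤ 2/x and D from
  -- comparing the weights at t and x.
  refine ⟨C * K + 2 * C' * D * K, by positivity, fun x s hx hs => ?_⟩
  have hw := decayWeight_nonneg a (mul_pos hx hs)
  have hwx := decayWeight_nonneg a hx
  by_cases hN : s ∈ N
  · have hball := hq.subset_ball hN
    rw [Metric.mem_ball, Real.dist_eq, abs_lt] at hball
    have hd : ∀ t ∈ Icc (x / 2) (2 * x),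
        HasDerivWithinAt (G k) (G (k + 1) t / t) (Icc (x / 2) (2 * x)) t := fun t ht =>
      (hG.hasDerivAt k t (by linarith [ht.1])).hasDerivWithinAt
    have hbd : ∀ t ∈ Icc (x / 2) (2 * x),
        ‖G (k + 1) t / t‖ ≤ 2 * C' * D * decayWeight a x / x := by
      intro t ht
      have ht0 : 0 < t := by linarith [ht.1]
      have hle : decayWeight a t ≤ D * decayWeight a x := by
        have := decayWeight_mul_le (l := t / x) ha (by rw [div_le_div_iff₀] <;> linarith [ht.1])
          (by rw [div_le_iff₀ hx]; exact ht.2) hx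
        rwa [div_mul_cancel₀ _ hx.ne'] at this
      rw [norm_div, Real.norm_eq_abs, Real.norm_of_nonneg ht0.le, div_le_div_iff₀ ht0 hx]
      calc |G (k + 1) t| * x ≤ C' * (D * decayWeight a x) * (2 * t) := by
            gcongr
            · exact (h' t ht0).trans (by gcongr)
            · linarith [ht.1]
        _ = _ := by ring
    have hmv := (convex_Icc (x / 2) (2 * x)).norm_image_sub_le_of_norm_hasDerivWithin_le hd hbd
      (show x ∈ Icc (x / 2) (2 * x) by constructor <;> linarith)
      (show x * s ∈ Icc (x / 2) (2 * x) by constructor <;> nlinarith)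
    have he : regularized q N (G k) x s = (G k (x * s) - G k x) * q s := by
      rw [regularized, indicator_of_mem hN]; ring
    rw [he, indicator_of_mem hN, abs_mul, Pi.one_apply, one_mul]
    calc |G k (x * s) - G k x| * |q s|
        ≤ 2 * C' * D * decayWeight a x / x * ‖x * s - x‖ * |q s| := by gcongr; exact hmv
      _ = 2 * C' * D * decayWeight a x * (|q s| * |s - 1|) := by
          rw [show x * s - x = x * (s - 1) by ring, norm_mul, Real.norm_of_nonneg hx.le,
            Real.norm_eq_abs]
          field_simp
      _ ≤ 2 * C' * D * decayWeight a x * K := by gcongr; exact hq.mul_le_of_mem s hN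
      _ = 2 * C' * D * K * decayWeight a x := by ring
      _ ≤ (C * K + 2 * C' * D * K) * (decayWeight a (x * s) * |κ s| + decayWeight a x) := by
          gcongr
          · linarith [mul_nonneg hC hK]
          · linarith [mul_nonneg hw (abs_nonneg (κ s))]
  · rw [regularized, indicator_of_notMem hN, indicator_of_notMem hN, mul_zero, sub_zero, zero_mul,
      add_zero, abs_mul]
    calc |G k (x * s)| * |q s| ≤ C * decayWeight a (x * s) * (K * |κ s|) := by
          gcongr
          · exact h _ (mul_pos hx hs)
          · exact (hq.le_of_notMem s hs hN).trans (by gcongr; exact le_abs_self _)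
      _ = C * K * (decayWeight a (x * s) * |κ s|) := by ring
      _ ≤ _ := by
          gcongr
          have : 0 ≤ 2 * C' * D * K := by positivity
          linarith

theorem PoleKernel.integrable_indicator_one {q κ : ℝ → ℝ} {N : Set ℝ} {K : ℝ}
    (hq : PoleKernel q κ N K) : Integrable (N.indicator (1 : ℝ → ℝ)) := by
  rw [integrable_indicator_iff hq.measurableSet]
  refine integrableOn_const ?_
  exact ((measure_mono hq.subset_ball).trans_lt measure_ball_lt_top).ne

theorem PoleKernel.integral_indicator_one_le {q κ : ℝ → ℝ} {N : Set ℝ} {K : ℝ}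
    (hq : PoleKernel q κ N K) : ∫ s in Ioi (0 : ℝ), N.indicator (1 : ℝ → ℝ) s ≤ 1 := by
  have h0 : ∀ s, 0 ≤ N.indicator (1 : ℝ → ℝ) s := fun s =>
    indicator_nonneg (fun _ _ => zero_le_one) s
  calc ∫ s in Ioi (0 : ℝ), N.indicator (1 : ℝ → ℝ) s ≤ ∫ s, N.indicator (1 : ℝ → ℝ) s :=
        setIntegral_le_integral hq.integrable_indicator_one (Eventually.of_forall h0)
    _ = volume.real N := by rw [integral_indicator_one hq.measurableSet]
    _ ≤ volume.real (Metric.ball (1 : ℝ) (1 / 2)) :=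
        measureReal_mono hq.subset_ball measure_ball_lt_top.ne
    _ = 1 := by rw [Real.volume_real_ball] <;> norm_num

theorem PoleKernel.integrable_bound {a : ℝ} {q κ : ℝ → ℝ} {N : Set ℝ} {K : ℝ}
    (hq : PoleKernel q κ N K)
    (hκ : ∀ x, 0 < x → IntegrableOn (fun s => decayWeight a (x * s) * |κ s|) (Ioi 0)) {x : ℝ}
    (hx : 0 < x) : IntegrableOn
      (fun s => decayWeight a (x * s) * |κ s| + N.indicator 1 s * decayWeight a x) (Ioi 0) :=
  (hκ x hx).add (hq.integrable_indicator_one.integrableOn.mul_const _)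

theorem EulerFamily.integrableOn_regularized {a : ℝ} (ha : -1 < a) {G : ℕ → ℝ → ℝ}
    (hG : EulerFamily a G) {q κ : ℝ → ℝ} {N : Set ℝ} {K : ℝ} (hq : PoleKernel q κ N K)
    (hκ : ∀ x, 0 < x → IntegrableOn (fun s => decayWeight a (x * s) * |κ s|) (Ioi 0))
    (k : ℕ) {x : ℝ} (hx : 0 < x) : IntegrableOn (regularized q N (G k) x) (Ioi 0) := by
  obtain ⟨B, hB, h⟩ := hG.abs_regularized_le ha hq k
  refine ((hq.integrable_bound hκ hx).const_mul B).mono'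
    (hG.aestronglyMeasurable_regularized hq k hx) ?_
  filter_upwards [ae_restrict_mem measurableSet_Ioi] with s hs using h x s hx hs

/-- The Euler operator in y acts on g(ys) and on the subtracted g(y) alike, so it commutes with the
regularization. Domination is uniform near x because the weights at y and ys are comparable to those
at x and xs. -/
theorem EulerFamily.hasDerivAt_integral_regularized {a : ℝ} (ha : -1 < a) {G : ℕ → ℝ → ℝ}
    (hG : EulerFamily a G) {q κ : ℝ → ℝ} {N : Set ℝ} {K : ℝ} (hq : PoleKernel q κ N K)
    (hκ : ∀ x, 0 < x → IntegrableOn (fun s => decayWeight a (x * s) * |κ s|) (Ioi 0))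
    (k : ℕ) {x : ℝ} (hx : 0 < x) :
    HasDerivAt (fun y => ∫ s in Ioi (0 : ℝ), regularized q N (G k) y s)
      (x⁻¹ * ∫ s in Ioi (0 : ℝ), regularized q N (G (k + 1)) x s) x := by
  obtain ⟨B, hB, h⟩ := hG.abs_regularized_le ha hq (k + 1)
  set D : ℝ := 2 ^ |a| * 2 ^ (a + 4) with hD
  have hD0 : 0 ≤ D := by positivity
  have hball : ∀ y ∈ Metric.ball x (x / 2), x / 2 < y ∧ y < 2 * x := by
    intro y hy
    rw [Metric.mem_ball, Real.dist_eq, abs_lt] at hy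
    constructor <;> linarith
  have key := hasDerivAt_integral_of_dominated_loc_of_deriv_le
    (μ := volume.restrict (Ioi (0 : ℝ))) (F := fun y s => regularized q N (G k) y s)
    (F' := fun y s => y⁻¹ * regularized q N (G (k + 1)) y s)
    (bound := fun s => 2 / x * (B * D) *
      (decayWeight a (x * s) * |κ s| + N.indicator 1 s * decayWeight a x))
    (Metric.ball_mem_nhds x (half_pos hx)) ?_ (hG.integrableOn_regularized ha hq hκ k hx) ?_ ?_
    ((hq.integrable_bound hκ hx).const_mul _) ?_
  · have := key.2
    rwa [integral_const_mul] at this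
  · filter_upwards [lt_mem_nhds hx] with y hy using hG.aestronglyMeasurable_regularized hq k hy
  · exact (hG.aestronglyMeasurable_regularized hq (k + 1) hx).const_mul _
  · filter_upwards [ae_restrict_mem measurableSet_Ioi] with s hs y hy
    obtain ⟨h1, h2⟩ := hball y hy
    have hy0 : 0 < y := by linarith
    have hs0 : 0 < s := hs
    have hcmp : ∀ t, 0 < t → decayWeight a (y / x * t) ≤ D * decayWeight a t := fun t ht =>
      decayWeight_mul_le ha (by rw [div_le_div_iff₀] <;> linarith)
        (by rw [div_le_iff₀ hx]; exact h2.le) ht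
    have hc1 := hcmp (x * s) (mul_pos hx hs)
    rw [← mul_assoc, div_mul_cancel₀ _ hx.ne'] at hc1
    have hc2 := hcmp x hx
    rw [div_mul_cancel₀ _ hx.ne'] at hc2
    have hi : 0 ≤ N.indicator (1 : ℝ → ℝ) s := indicator_nonneg (fun _ _ => zero_le_one) s
    have hw := decayWeight_nonneg a (mul_pos hx hs0)
    have hwy := decayWeight_nonneg a (mul_pos hy0 hs0)
    have hwx := decayWeight_nonneg a hx
    have hwy' := decayWeight_nonneg a hy0
    have hinv : y⁻¹ ≤ 2 / x := by
      rw [← one_div, div_le_div_iff₀ hy0 hx]; linarith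
    rw [norm_mul, norm_inv, Real.norm_of_nonneg hy0.le, Real.norm_eq_abs]
    calc y⁻¹ * |regularized q N (G (k + 1)) y s|
        ≤ 2 / x * (B * (D * decayWeight a (x * s) * |κ s| +
            N.indicator 1 s * (D * decayWeight a x))) := by
          refine mul_le_mul hinv ((h y s hy0 hs).trans ?_) (abs_nonneg _) (by positivity)
          gcongr
      _ = _ := by ring
  · filter_upwards [ae_restrict_mem measurableSet_Ioi] with s hs y hy
    obtain ⟨h1, -⟩ := hball y hy
    have hy0 : 0 < y := by linarith
    have hs0 : 0 < s := hs
    have e1 : HasDerivAt (fun y => G k (y * s)) (G (k + 1) (y * s) / (y * s) * s) y := by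
      have := (hG.hasDerivAt k (y * s) (mul_pos hy0 hs)).comp y ((hasDerivAt_id y).mul_const s)
      simpa [Function.comp_def] using this
    refine ((e1.mul_const (q s)).sub
      ((hG.hasDerivAt k y hy0).mul_const (N.indicator q s))).congr_deriv ?_
    unfold regularized
    field_simp

theorem EulerFamily.abs_integral_regularized_le {a : ℝ} (ha : -1 < a) {G : ℕ → ℝ → ℝ}
    (hG : EulerFamily a G) {q κ : ℝ → ℝ} {N : Set ℝ} {K : ℝ} (hq : PoleKernel q κ N K)
    (hκ : ∀ x, 0 < x → IntegrableOn (fun s => decayWeight a (x * s) * |κ s|) (Ioi 0))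
    (k : ℕ) : ∃ B, 0 ≤ B ∧ ∀ x, 0 < x → |∫ s in Ioi (0 : ℝ), regularized q N (G k) x s| ≤
      B * ((∫ s in Ioi (0 : ℝ), decayWeight a (x * s) * |κ s|) + decayWeight a x) := by
  obtain ⟨B, hB, h⟩ := hG.abs_regularized_le ha hq k
  refine ⟨B, hB, fun x hx => ?_⟩
  have hle := norm_integral_le_of_norm_le ((hq.integrable_bound hκ hx).const_mul B)
    (f := regularized q N (G k) x) (by
      filter_upwards [ae_restrict_mem measurableSet_Ioi] with s hs using h x s hx hs)
  rw [integral_const_mul, integral_add (hκ x hx)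
    (hq.integrable_indicator_one.integrableOn.mul_const _), integral_mul_const] at hle
  refine hle.trans ?_
  gcongr
  exact mul_le_of_le_one_left (decayWeight_nonneg a hx) hq.integral_indicator_one_le

theorem PoleKernel.integrableOn_indicator {q κ : ℝ → ℝ} {N : Set ℝ} {K : ℝ}
    (hq : PoleKernel q κ N K) {δ : ℝ} (hδ : 0 < δ) :
    IntegrableOn (N.indicator q) (puncturedRay 1 δ) := by
  refine (hq.integrable_indicator_one.const_mul (K / δ)).integrableOn.mono'
    (hq.measurable.indicator hq.measurableSet).aestronglyMeasurable ?_
  filter_upwards [ae_restrict_mem (measurableSet_puncturedRay 1 δ)] with s hs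
  by_cases hN : s ∈ N
  · rw [indicator_of_mem hN, indicator_of_mem hN, Pi.one_apply, mul_one, Real.norm_eq_abs,
      le_div_iff₀ hδ]
    exact (mul_le_mul_of_nonneg_left hs.2.le (abs_nonneg _)).trans (hq.mul_le_of_mem s hN)
  · simp [indicator_of_notMem hN]

theorem EulerFamily.integrableOn_puncturedRay {a : ℝ} (ha : -1 < a) {G : ℕ → ℝ → ℝ}
    (hG : EulerFamily a G) {q κ : ℝ → ℝ} {N : Set ℝ} {K : ℝ} (hq : PoleKernel q κ N K)
    (hκ : ∀ x, 0 < x → IntegrableOn (fun s => decayWeight a (x * s) * |κ s|) (Ioi 0))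
    (k : ℕ) {x δ : ℝ} (hx : 0 < x) (hδ : 0 < δ) :
    IntegrableOn (fun s => G k (x * s) * q s) (puncturedRay 1 δ) := by
  have h := ((hG.integrableOn_regularized ha hq hκ k hx).mono_set
    (puncturedRay_subset_Ioi 1 δ)).add ((hq.integrableOn_indicator hδ).const_mul (G k x))
  refine h.congr (Eventually.of_forall fun s => ?_)
  simp [regularized]

/-- The regularized integral is the principal value. -/
theorem EulerFamily.tendsto_integral_puncturedRay {a : ℝ} (ha : -1 < a) {G : ℕ → ℝ → ℝ}
    (hG : EulerFamily a G) {q κ : ℝ → ℝ} {N : Set ℝ} {K : ℝ} (hq : PoleKernel q κ N K)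
    (hκ : ∀ x, 0 < x → IntegrableOn (fun s => decayWeight a (x * s) * |κ s|) (Ioi 0))
    (k : ℕ) {x : ℝ} (hx : 0 < x) :
    Tendsto (fun δ => ∫ s in puncturedRay 1 δ, G k (x * s) * q s) (𝓝[>] 0)
      (𝓝 (∫ s in Ioi (0 : ℝ), regularized q N (G k) x s)) := by
  have hi := hG.integrableOn_regularized ha hq hκ k hx
  -- For every δ > 0 the truncated integrals with and without the subtraction agree, by the
  -- cancellation on N.
  refine (_root_.tendsto_integral_puncturedRay 1 hi).congr' ?_
  filter_upwards [self_mem_nhdsWithin] with δ (hδ : 0 < δ)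
  have h1 : ∫ s in puncturedRay 1 δ, regularized q N (G k) x s =
      (∫ s in puncturedRay 1 δ, G k (x * s) * q s) -
        ∫ s in puncturedRay 1 δ, G k x * N.indicator q s :=
    integral_sub (hG.integrableOn_puncturedRay ha hq hκ k hx hδ)
      ((hq.integrableOn_indicator hδ).const_mul _)
  rw [h1, integral_const_mul, hq.integral_eq_zero δ hδ, mul_zero, sub_zero]

/-! ### From the Euler operator to ordinary derivatives -/

section EulerSequence

variable {E : Type*} [NormedAddCommGroup E] [NormedSpace ℝ E]

/-- Apply the operators `θ - 0`, `θ - 1`, …, `θ - (k-1)` to a sequence on which `θ` is the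
shift. -/
def fallingShift (f : ℕ → ℝ → E) : ℕ → ℕ → ℝ → E
  | 0, j, z => f j z
  | k + 1, j, z => fallingShift f k (j + 1) z - (k : ℝ) • fallingShift f k j z

variable {f : ℕ → ℝ → E}

theorem hasDerivAt_fallingShift
    (hf : ∀ j z, z < 0 → HasDerivAt (f j) (z⁻¹ • f (j + 1) z) z) (k j : ℕ) {z : ℝ} (hz : z < 0) :
    HasDerivAt (fallingShift f k j) (z⁻¹ • fallingShift f k (j + 1) z) z := by
  induction k generalizing j with
  | zero => exact hf j z hz
  | succ k ih =>
    refine ((ih (j + 1)).sub ((ih j).const_smul (k : ℝ))).congr_deriv ?_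
    simp only [fallingShift, smul_sub]
    rw [smul_comm]

/-- This is z^k (d/dz)^k = θ(θ-1)⋯(θ-k+1). The induction step gains the term -k from differentiating
z^(-k). -/
theorem iteratedDeriv_eq_fallingShift
    (hf : ∀ j z, z < 0 → HasDerivAt (f j) (z⁻¹ • f (j + 1) z) z) (k : ℕ) {z : ℝ} (hz : z < 0) :
    iteratedDeriv k (f 0) z = (z ^ k)⁻¹ • fallingShift f k 0 z := by
  induction k generalizing z with
  | zero => simp [fallingShift]
  | succ k ih =>
    have he : iteratedDeriv k (f 0) =ᶠ[𝓝 z] fun y => (y ^ k)⁻¹ • fallingShift f k 0 y := by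
      filter_upwards [Iio_mem_nhds hz] with y hy using ih hy
    rw [iteratedDeriv_succ, he.deriv_eq]
    have h1 := ((hasDerivAt_pow k z).fun_inv (pow_ne_zero k hz.ne)).smul
      (hasDerivAt_fallingShift hf k 0 hz)
    refine (h1.congr_deriv ?_).deriv
    simp only [fallingShift, smul_sub, smul_smul]
    rw [sub_eq_add_neg, ← neg_smul]
    congr 2
    · rw [pow_succ, mul_inv]
    · rcases k with _ | k
      · simp
      · have := hz.ne
        simp only [Nat.add_sub_cancel]
        field_simp
        ring

theorem norm_fallingShift_le {Φ : ℝ → ℝ} (hΦ : ∀ z, z < 0 → 0 ≤ Φ z)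
    (hb : ∀ j, ∃ C, 0 ≤ C ∧ ∀ z, z < 0 → ‖f j z‖ ≤ C * Φ z) (k j : ℕ) :
    ∃ C, 0 ≤ C ∧ ∀ z, z < 0 → ‖fallingShift f k j z‖ ≤ C * Φ z := by
  induction k generalizing j with
  | zero => exact hb j
  | succ k ih =>
    obtain ⟨C, hC, h⟩ := ih (j + 1)
    obtain ⟨D, hD, h'⟩ := ih j
    refine ⟨C + k * D, by positivity, fun z hz => ?_⟩
    have := hΦ z hz
    calc _ ≤ ‖fallingShift f k (j + 1) z‖ + ‖(k : ℝ) • fallingShift f k j z‖ := norm_sub_le _ _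
      _ ≤ C * Φ z + k * (D * Φ z) := by
          rw [norm_smul, Real.norm_natCast]
          gcongr
          · exact h z hz
          · exact h' z hz
      _ = _ := by ring

/-- Bootstrap: each derivative is z⁻¹ times the next member, so C^n for all members gives C^(n+1)
for each. -/
theorem contDiffOn_of_eulerSequence
    (hf : ∀ j z, z < 0 → HasDerivAt (f j) (z⁻¹ • f (j + 1) z) z) (j : ℕ) :
    ContDiffOn ℝ ∞ (f j) (Iio 0) := by
  rw [contDiffOn_infty]
  intro n
  induction n generalizing j with
  | zero =>
    exact contDiffOn_zero.2 fun z hz => (hf j z hz).continuousAt.continuousWithinAt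
  | succ n ih =>
    push_cast
    rw [contDiffOn_succ_iff_deriv_of_isOpen isOpen_Iio]
    refine ⟨fun z hz => (hf j z hz).differentiableAt.differentiableWithinAt, by simp, ?_⟩
    refine (ContDiffOn.smul (contDiffOn_id.inv fun z (hz : z < 0) => hz.ne) (ih (j + 1))).congr ?_
    intro z hz
    exact (hf j z hz).deriv

/-- If `θ = z d/dz` acts on a sequence of functions as the shift, bounds on the sequence give
bounds on the derivatives of its first member. -/
theorem norm_iteratedDeriv_le_of_eulerSequence {Φ : ℝ → ℝ} (hΦ : ∀ z, z < 0 → 0 ≤ Φ z)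
    (hf : ∀ j z, z < 0 → HasDerivAt (f j) (z⁻¹ • f (j + 1) z) z)
    (hb : ∀ j, ∃ C, 0 ≤ C ∧ ∀ z, z < 0 → ‖f j z‖ ≤ C * Φ z) (k : ℕ) :
    ∃ C, 0 < C ∧ ∀ z, z < 0 → ‖iteratedDeriv k (f 0) z‖ ≤ C * (|z| ^ (-(k : ℝ)) * Φ z) := by
  obtain ⟨C, hC, h⟩ := norm_fallingShift_le hΦ hb k 0
  refine ⟨C + 1, by positivity, fun z hz => ?_⟩
  have hz' : 0 < |z| := abs_pos.2 hz.ne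
  have := hΦ z hz
  rw [iteratedDeriv_eq_fallingShift hf k hz, norm_smul, norm_inv, norm_pow, Real.norm_eq_abs,
    Real.rpow_neg hz'.le, Real.rpow_natCast]
  calc (|z| ^ k)⁻¹ * ‖fallingShift f k 0 z‖ ≤ (|z| ^ k)⁻¹ * ((C + 1) * Φ z) := by
        gcongr
        exact (h z hz).trans (by gcongr; linarith)
    _ = _ := by ring

end EulerSequence

/-! ### Size of the weighted integrals near 0 and infinity -/

theorem integrableOn_decayWeight_dilate_mul {a : ℝ} (ha : -1 < a) {κ : ℝ → ℝ}
    (hm : Measurable κ) (hκ : ∀ s, 0 < s → |κ s| ≤ 1) {x : ℝ} (hx : 0 < x) :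
    IntegrableOn (fun s => decayWeight a (x * s) * |κ s|) (Ioi 0) := by
  refine (integrableOn_decayWeight_dilate (p := 0) ha (by linarith) (by norm_num) hx).mono'
    (((measurable_decayWeight a).comp (measurable_const_mul x)).mul
      (measurable_norm.comp hm)).aestronglyMeasurable ?_
  filter_upwards [ae_restrict_mem measurableSet_Ioi] with s hs
  have := decayWeight_nonneg a (mul_pos hx hs)
  rw [Real.norm_of_nonneg (by positivity), Real.rpow_zero]
  exact mul_le_mul_of_nonneg_left (hκ s hs) this

/-- The substitution t = xs gives the power of x. It serves with p = 0 or 1 at infinity, and with p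
= -1 near 0 when β < 1. -/
theorem integral_decayWeight_dilate_mul_le {a p : ℝ} (ha : -1 < a) (hp : -1 < a + p)
    (hp' : p < 3) {κ : ℝ → ℝ} (hm : Measurable κ) (hκ1 : ∀ s, 0 < s → |κ s| ≤ 1)
    (hκ : ∀ s, 0 < s → |κ s| ≤ s ^ p) {x : ℝ} (hx : 0 < x) :
    ∫ s in Ioi (0 : ℝ), decayWeight a (x * s) * |κ s| ≤
      (∫ t in Ioi (0 : ℝ), decayWeight a t * t ^ p) * x ^ (-(p + 1)) := by
  rw [mul_comm, show -(p + 1) = -p - 1 by ring, ← integral_decayWeight_dilate a p hx]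
  refine setIntegral_mono_on (integrableOn_decayWeight_dilate_mul ha hm hκ1 hx)
    (integrableOn_decayWeight_dilate ha hp hp' hx) measurableSet_Ioi fun s hs => ?_
  exact mul_le_mul_of_nonneg_left (hκ s hs) (decayWeight_nonneg a (mul_pos hx hs))

theorem integral_decayWeight_dilate_mul_le_rpow {a : ℝ} (ha : -1 < a) {κ : ℝ → ℝ}
    (hm : Measurable κ) (hκ1 : ∀ s, 0 < s → |κ s| ≤ 1)
    (hi : IntegrableOn (fun s => s ^ a * |κ s|) (Ioi 0)) {x : ℝ} (hx : 0 < x) :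
    ∫ s in Ioi (0 : ℝ), decayWeight a (x * s) * |κ s| ≤
      (∫ s in Ioi (0 : ℝ), s ^ a * |κ s|) * x ^ a := by
  rw [mul_comm, ← integral_const_mul]
  refine setIntegral_mono_on (integrableOn_decayWeight_dilate_mul ha hm hκ1 hx)
    (hi.const_mul _) measurableSet_Ioi fun s (hs : 0 < s) => ?_
  rw [← mul_assoc, ← Real.mul_rpow hx.le hs.le]
  exact mul_le_mul_of_nonneg_right (decayWeight_le_rpow ha (mul_pos hx hs)) (abs_nonneg _)

/-- A bound of order `x^(-b)` at `0` and one of order `x^(-e)` at infinity combine. -/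
theorem exists_le_rpow_mul_one_add_rpow {J : ℝ → ℝ} {b e A B : ℝ} (hbe : b ≤ e) (hA : 0 ≤ A)
    (hB : 0 ≤ B) (h0 : ∀ x, 0 < x → x ≤ 1 → J x ≤ A * x ^ (-b))
    (h1 : ∀ x, 1 ≤ x → J x ≤ B * x ^ (-e)) :
    ∃ C, 0 ≤ C ∧ ∀ x, 0 < x → J x ≤ C * (x ^ (-b) * (1 + x) ^ (-e + b)) := by
  refine ⟨(A + B) * 2 ^ (e - b), by positivity, fun x hx => ?_⟩
  rcases le_total x 1 with h | h
  · have h2 : (2 : ℝ) ^ (-e + b) ≤ (1 + x) ^ (-e + b) :=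
      Real.rpow_le_rpow_of_nonpos (by positivity) (by linarith) (by linarith)
    calc J x ≤ A * x ^ (-b) := h0 x hx h
      _ = A * 2 ^ (e - b) * (x ^ (-b) * 2 ^ (-e + b)) := by
          rw [show -e + b = -(e - b) by ring, Real.rpow_neg (by norm_num : (0 : ℝ) ≤ 2)]
          field_simp
      _ ≤ _ := by gcongr; linarith
  · have h2 : x ^ (-e + b) ≤ 2 ^ (e - b) * (1 + x) ^ (-e + b) := by
      calc x ^ (-e + b) ≤ (2⁻¹ * (1 + x)) ^ (-e + b) :=
            Real.rpow_le_rpow_of_nonpos (by positivity) (by linarith) (by linarith)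
        _ = _ := by
          rw [Real.mul_rpow (by norm_num) (by positivity), Real.inv_rpow (by norm_num),
            ← Real.rpow_neg (by norm_num)]
          ring_nf
    calc J x ≤ B * x ^ (-e) := h1 x h
      _ = B * (x ^ (-b) * x ^ (-e + b)) := by rw [← Real.rpow_add hx]; ring_nf
      _ ≤ B * (x ^ (-b) * (2 ^ (e - b) * (1 + x) ^ (-e + b))) := by gcongr
      _ = B * 2 ^ (e - b) * (x ^ (-b) * (1 + x) ^ (-e + b)) := by ring
      _ ≤ _ := by gcongr; linarith

/-- The modulus `x^(-(β-1)₊/α) (1+x)^(-1 or -2 + (β-1)₊/α)` of the estimate. -/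
noncomputable def popovModulus (α β x : ℝ) : ℝ :=
  x ^ (-(max (β - 1) 0) / α) *
    (1 + x) ^ ((if α = β then (-2 : ℝ) else -1) + max (β - 1) 0 / α)

section Exponents

variable {α β : ℝ}

theorem neg_one_lt_exponent (hα : 0 < α) (hβ : β < 1 + α) : -1 < (1 - β) / α := by
  rw [lt_div_iff₀ hα]; linarith

theorem max_div_lt_one (hα : 0 < α) (hβ : β < 1 + α) : max (β - 1) 0 / α < 1 := by
  rw [div_lt_one hα, max_lt_iff]; constructor <;> linarith

theorem exists_integral_le_popovModulus (hα : 0 < α) (hβ : β < 1 + α) {p : ℝ}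
    (hp : p = if α = β then 1 else 0) {κ : ℝ → ℝ} (hm : Measurable κ)
    (hκ1 : ∀ s, 0 < s → |κ s| ≤ 1) (hκp : ∀ s, 0 < s → |κ s| ≤ s ^ p)
    (hκ : ∀ s, 0 < s → |κ s| ≤ 1 / (1 + s))
    (hκ' : β = 1 → ∀ s, 0 < s → |κ s| ≤ 1 / (1 + s) ^ 2) :
    ∃ C, 0 ≤ C ∧ ∀ x, 0 < x →
      ∫ s in Ioi (0 : ℝ), decayWeight ((1 - β) / α) (x * s) * |κ s| ≤
        C * popovModulus α β x := by
  set a := (1 - β) / α with ha_def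
  have ha : -1 < a := neg_one_lt_exponent hα hβ
  have hb1 := max_div_lt_one hα hβ
  have hp01 : 0 ≤ p ∧ p ≤ 1 := by rw [hp]; split_ifs <;> norm_num
  have hmod : ∀ x, popovModulus α β x =
      x ^ (-(max (β - 1) 0 / α)) * (1 + x) ^ (-(p + 1) + max (β - 1) 0 / α) := fun x => by
    rw [popovModulus, neg_div, hp]; split_ifs <;> norm_num
  simp_rw [hmod]
  have hint : ∀ r : ℝ, 0 ≤ ∫ t in Ioi (0 : ℝ), decayWeight a t * t ^ r := fun r =>
    setIntegral_nonneg measurableSet_Ioi fun t (ht : 0 < t) =>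
      mul_nonneg (decayWeight_nonneg a ht) (by positivity)
  have hint' : 0 ≤ ∫ s in Ioi (0 : ℝ), s ^ a * |κ s| :=
    setIntegral_nonneg measurableSet_Ioi fun t (ht : 0 < t) => by positivity
  have hlarge := fun x (hx : 1 ≤ x) => integral_decayWeight_dilate_mul_le ha (p := p)
    (by linarith) (by linarith) hm hκ1 hκp (x := x) (by linarith)
  rcases lt_or_ge β 1 with hlt | hge
  · have ha0 : 0 < a := div_pos (by linarith) hα
    -- As a > 0, the weight is integrable against t^(-1), and κ ≤ 1/s yields a bound of order x^0.
    refine exists_le_rpow_mul_one_add_rpow (by linarith) (hint (-1)) (hint p) ?_ hlarge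
    intro x hx _
    have := integral_decayWeight_dilate_mul_le ha (p := -1) (by linarith) (by norm_num) hm hκ1
      (fun s hs => (hκ s hs).trans (by
        rw [Real.rpow_neg_one, ← one_div]; exact one_div_le_one_div_of_le hs (by linarith))) hx
    rw [max_eq_right (by linarith)]
    simpa using this
  · have hba : -(max (β - 1) 0 / α) = a := by
      rw [max_eq_left (by linarith), ha_def]; ring
    refine exists_le_rpow_mul_one_add_rpow (by linarith) hint' (hint p) ?_ hlarge
    intro x hx _
    rw [hba]
    refine integral_decayWeight_dilate_mul_le_rpow ha hm hκ1 ?_ hx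
    have hmeas : Measurable fun s : ℝ => s ^ a * |κ s| :=
      (by fun_prop : Measurable fun s : ℝ => s ^ a).mul (measurable_norm.comp hm)
    have hle : ∀ s : ℝ, 0 < s → |s ^ a * abs (κ s)| ≤ s ^ a := fun s hs => by
      rw [abs_of_nonneg (by positivity)]
      exact mul_le_of_le_one_right (by positivity) (hκ1 s hs)
    -- For β = 1 the exponent a is 0, and decay like 1/s would leave a logarithmic divergence; hence
    -- the second-order hypothesis `hκ'`.
    rcases hge.eq_or_lt with h1 | hgt
    · refine integrableOn_Ioi_of_le_rpow hmeas ha (r := a - 2) ?_ hle fun s hs => ?_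
      · have : a = 0 := by rw [ha_def, ← h1]; simp
        linarith
      · rw [abs_of_nonneg (by positivity), Real.rpow_sub hs, div_eq_mul_one_div, Real.rpow_two]
        gcongr
        refine (hκ' h1.symm s hs).trans ?_
        gcongr; linarith
    · have ha0 : a < 0 := div_neg_of_neg_of_pos (by linarith) hα
      refine integrableOn_Ioi_of_le_rpow hmeas ha (r := a - 1) (by linarith) hle fun s hs => ?_
      rw [abs_of_nonneg (by positivity), Real.rpow_sub hs, div_eq_mul_one_div, Real.rpow_one]
      gcongr
      refine (hκ s hs).trans ?_
      gcongr; linarith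

/-- This controls the contribution of N. It holds since a + (β-1)₊/α ≥ 0 near 0 and -4 ≤ -2 at
infinity. -/
theorem decayWeight_le_popovModulus (hα : 0 < α) {x : ℝ} (hx : 0 < x) :
    decayWeight ((1 - β) / α) x ≤ popovModulus α β x := by
  set b := max (β - 1) 0 / α with hb
  have hab : 0 ≤ (1 - β) / α + b := by
    rw [hb, ← add_div]
    refine div_nonneg ?_ hα.le
    linarith [le_max_left (β - 1) 0]
  have h1 : (1 : ℝ) ≤ 1 + x := by linarith
  unfold decayWeight popovModulus
  rw [neg_div, ← hb]
  calc x ^ ((1 - β) / α) * (1 + x) ^ (-((1 - β) / α + 4))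
      = x ^ (-b) * (x ^ ((1 - β) / α + b) * (1 + x) ^ (-((1 - β) / α + 4))) := by
        rw [← mul_assoc, ← Real.rpow_add hx]; ring_nf
    _ ≤ x ^ (-b) * ((1 + x) ^ ((1 - β) / α + b) * (1 + x) ^ (-((1 - β) / α + 4))) := by
        gcongr; linarith
    _ = x ^ (-b) * (1 + x) ^ (b - 4) := by
        rw [← Real.rpow_add (by positivity)]; ring_nf
    _ ≤ _ := by
        gcongr ?_ * ?_
        refine Real.rpow_le_rpow_of_exponent_le h1 ?_
        split_ifs <;> linarith

end Exponents

/-! ### The Popov kernel -/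

/-- The kernel of the Popov integral in the variable `s = τ / |z|`. -/
noncomputable def popovKernel (α β s : ℝ) : ℝ :=
  (s * Real.sin (Real.pi * β) + Real.sin (Real.pi * (β - α))) /
    (s ^ 2 + 2 * s * Real.cos (Real.pi * α) + 1)

theorem measurable_popovKernel (α β : ℝ) : Measurable (popovKernel α β) := by
  unfold popovKernel; fun_prop

theorem neg_one_lt_cos_of_not_odd {α : ℝ} (h : ¬ ∃ m : ℤ, α = 2 * (m : ℝ) + 1) :
    -1 < Real.cos (Real.pi * α) := by
  refine (Real.neg_one_le_cos _).lt_of_ne' fun hc => h ?_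
  obtain ⟨n, hn⟩ := Real.cos_eq_neg_one_iff.1 hc
  refine ⟨n, ?_⟩
  have : Real.pi * α = Real.pi * (2 * n + 1) := by rw [← hn]; ring
  exact mul_left_cancel₀ Real.pi_ne_zero this

/-- With c = cos πα, s² + 2cs + 1 = (1+c)/2 · (1+s)² + (1-c)/2 · (s-1)², so the denominator has no
zero when c > -1. -/
theorem abs_popovKernel_le {α : ℝ} (hα : ¬ ∃ m : ℤ, α = 2 * (m : ℝ) + 1) (β : ℝ) {s : ℝ}
    (hs : 0 < s) : |popovKernel α β s| ≤ ((1 + Real.cos (Real.pi * α)) / 2)⁻¹ *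
      (|s * Real.sin (Real.pi * β) + Real.sin (Real.pi * (β - α))| / (1 + s) ^ 2) := by
  have hc := neg_one_lt_cos_of_not_odd hα
  set c := Real.cos (Real.pi * α) with hcdef
  have hc1 : c ≤ 1 := Real.cos_le_one _
  have hd : 0 < (1 + c) / 2 := by linarith
  have hden : (1 + c) / 2 * (1 + s) ^ 2 ≤ s ^ 2 + 2 * s * c + 1 := by
    nlinarith [mul_nonneg (sub_nonneg.2 hc1) (sq_nonneg (s - 1))]
  have hpos : 0 < (1 + c) / 2 * (1 + s) ^ 2 := by positivity
  rw [popovKernel, abs_div, ← hcdef, abs_of_pos (hpos.trans_le hden), inv_mul_eq_div, div_div,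
    mul_comm ((1 + s) ^ 2)]
  gcongr

theorem popovKernel_of_odd {α : ℝ} (hα : ∃ m : ℤ, α = 2 * (m : ℝ) + 1) (β s : ℝ) :
    popovKernel α β s = Real.sin (Real.pi * β) / (s - 1) := by
  obtain ⟨m, rfl⟩ := hα
  have h1 : Real.cos (Real.pi * (2 * m + 1)) = -1 :=
    Real.cos_eq_neg_one_iff.2 ⟨m, by ring⟩
  have h2 : Real.sin (Real.pi * (β - (2 * m + 1))) = -Real.sin (Real.pi * β) := by
    rw [show Real.pi * (β - (2 * m + 1)) = Real.pi * β - Real.pi - m * (2 * Real.pi) by ring,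
      Real.sin_sub_int_mul_two_pi, Real.sin_sub_pi]
  rw [popovKernel, h1, h2]
  -- At s = 1 both sides are 0, by the convention on division by zero.
  rcases eq_or_ne s 1 with rfl | hs
  · norm_num
  · have : s - 1 ≠ 0 := sub_ne_zero.2 hs
    rw [show s ^ 2 + 2 * s * -1 + 1 = (s - 1) * (s - 1) by ring,
      show s * Real.sin (Real.pi * β) + -Real.sin (Real.pi * β) =
        (s - 1) * Real.sin (Real.pi * β) by ring, mul_div_mul_left _ _ this]

theorem poleKernel_of_abs_le {q κ : ℝ → ℝ} {K : ℝ} (hm : Measurable q) (hK : 0 ≤ K)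
    (h : ∀ s, 0 < s → |q s| ≤ K * κ s) : PoleKernel q κ ∅ K where
  measurable := hm
  measurableSet := MeasurableSet.empty
  subset_ball := empty_subset _
  nonneg := hK
  le_of_notMem s hs _ := h s hs
  mul_le_of_mem s hs := hs.elim
  integral_eq_zero δ _ := by simp

/-- Cancellation comes from the reflection s ↦ 2 - s: the ball and the cut are symmetric about 1 and
the kernel is odd. The ball lies in s > 0, so the half-line does not break the symmetry. -/
theorem poleKernel_popovKernel_of_odd {α : ℝ} (hα : ∃ m : ℤ, α = 2 * (m : ℝ) + 1) (β : ℝ) :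
    PoleKernel (popovKernel α β) (fun s => 1 / (1 + s)) (Metric.ball 1 (1 / 2)) 5 where
  measurable := measurable_popovKernel α β
  measurableSet := measurableSet_ball
  subset_ball := Subset.rfl
  nonneg := by norm_num
  le_of_notMem s hs hN := by
    rw [Metric.mem_ball, Real.dist_eq, not_lt] at hN
    have hpos : 0 < |s - 1| := by linarith
    rw [popovKernel_of_odd hα, abs_div, mul_one_div, div_le_div_iff₀ hpos (by linarith)]
    -- The constant 5 is attained at s = 3/2.
    have h2 : 1 + s ≤ 5 * |s - 1| := by
      rcases le_total 1 s with h | h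
      · rw [abs_of_nonneg (by linarith)] at hN ⊢; linarith
      · rw [abs_of_nonpos (by linarith)] at hN ⊢; linarith
    exact (mul_le_of_le_one_left (by linarith) (Real.abs_sin_le_one _)).trans h2
  mul_le_of_mem s _ := by
    rw [popovKernel_of_odd hα, ← abs_mul]
    rcases eq_or_ne s 1 with rfl | hs
    · norm_num
    · rw [div_mul_cancel₀ _ (sub_ne_zero.2 hs)]
      exact (Real.abs_sin_le_one _).trans (by norm_num)
  integral_eq_zero δ _ := by
    rw [← integral_indicator (measurableSet_puncturedRay 1 δ)]
    set h : ℝ → ℝ := (puncturedRay 1 δ).indicator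
      ((Metric.ball 1 (1 / 2)).indicator (popovKernel α β)) with hh
    have hodd : ∀ s, h (2 - s) = -h s := by
      intro s
      have e1 : |2 - s - 1| = |s - 1| := by rw [← abs_neg]; ring_nf
      have key : ∀ t, h t = if |t - 1| < 1 / 2 ∧ δ < |t - 1| then
          Real.sin (Real.pi * β) / (t - 1) else 0 := by
        intro t
        classical
        rw [hh, indicator_indicator, indicator_apply, popovKernel_of_odd hα]
        congr 1
        simp only [mem_inter_iff, puncturedRay, mem_ofPred_eq, Metric.mem_ball, Real.dist_eq,
          eq_iff_iff]
        constructor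
        · rintro ⟨⟨-, h1⟩, h2⟩; exact ⟨h2, h1⟩
        · rintro ⟨h2, h1⟩
          exact ⟨⟨by linarith [(abs_lt.1 h2).1], h1⟩, h2⟩
      rw [key, key, e1]
      split_ifs
      · rw [← div_neg]; ring_nf
      · simp
    have h1 : ∫ s, h (2 - s) = ∫ s, h s := integral_sub_left_eq_self h volume 2
    simp_rw [hodd, integral_neg] at h1
    linarith

/-- The dominating κ must follow the vanishing of each numerator coefficient: sin π(β-α) = 0 when α
= β gives the zero at s = 0, and sin πβ = 0 when β = 1 gives the faster decay at infinity. -/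
theorem exists_poleKernel_popovKernel {α β : ℝ} (hα : 0 < α) (hβ : β < 1 + α) :
    ∃ (κ : ℝ → ℝ) (N : Set ℝ) (K : ℝ), PoleKernel (popovKernel α β) κ N K ∧
      ((¬ ∃ m : ℤ, α = 2 * (m : ℝ) + 1) → N = ∅) ∧
      (∀ x, 0 < x →
        IntegrableOn (fun s => decayWeight ((1 - β) / α) (x * s) * |κ s|) (Ioi 0)) ∧
      ∃ C, 0 ≤ C ∧ ∀ x, 0 < x →
        ∫ s in Ioi (0 : ℝ), decayWeight ((1 - β) / α) (x * s) * |κ s| ≤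
          C * popovModulus α β x := by
  have ha := neg_one_lt_exponent hα hβ
  suffices H : ∃ (κ : ℝ → ℝ) (N : Set ℝ) (K : ℝ), PoleKernel (popovKernel α β) κ N K ∧
      ((¬ ∃ m : ℤ, α = 2 * (m : ℝ) + 1) → N = ∅) ∧ Measurable κ ∧
      (∀ s, 0 < s → |κ s| ≤ s ^ (if α = β then 1 else 0 : ℝ)) ∧
      (∀ s, 0 < s → |κ s| ≤ 1 / (1 + s)) ∧
      (β = 1 → ∀ s, 0 < s → |κ s| ≤ 1 / (1 + s) ^ 2) by
    obtain ⟨κ, N, K, h1, h2, h3, h4, h5, h6⟩ := H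
    have h7 : ∀ s, 0 < s → |κ s| ≤ 1 := fun s hs =>
      (h5 s hs).trans ((div_le_one (by linarith)).2 (by linarith))
    exact ⟨κ, N, K, h1, h2, fun x hx => integrableOn_decayWeight_dilate_mul ha h3 h7 hx,
      exists_integral_le_popovModulus hα hβ rfl h3 h7 h4 h5 h6⟩
  by_cases hodd : ∃ m : ℤ, α = 2 * (m : ℝ) + 1
  · by_cases hdeg : α = β ∨ β = 1
    · have hsin : Real.sin (Real.pi * β) = 0 := by
        rcases hdeg with rfl | rfl
        · obtain ⟨m, rfl⟩ := hodd
          rw [Real.sin_eq_zero_iff]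
          exact ⟨2 * m + 1, by push_cast; ring⟩
        · simp
      refine ⟨0, ∅, 0, poleKernel_of_abs_le (measurable_popovKernel α β) le_rfl fun s _ => ?_,
        fun h => absurd hodd h, measurable_const, ?_, ?_, ?_⟩
      · simp [popovKernel_of_odd hodd, hsin]
      all_goals
        intros
        simp only [Pi.zero_apply, abs_zero]
        positivity
    · rw [not_or] at hdeg
      refine ⟨_, _, _, poleKernel_popovKernel_of_odd hodd β, fun h => absurd hodd h,
        by fun_prop, fun s hs => ?_, fun s hs => ?_, fun h => absurd h hdeg.2⟩
      · rw [if_neg hdeg.1, Real.rpow_zero, abs_of_pos (by positivity)]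
        exact (div_le_one (by linarith)).2 (by linarith)
      · rw [abs_of_pos (by positivity)]
  · have hc := neg_one_lt_cos_of_not_odd hodd
    have hK : 0 ≤ ((1 + Real.cos (Real.pi * α)) / 2)⁻¹ := by
      rw [inv_nonneg]; linarith
    have hb := fun s hs => abs_popovKernel_le hodd β (s := s) hs
    -- The two degenerate cases meet only at α = β = 1, where α is odd.
    have hne : α = β → β ≠ 1 := by
      rintro rfl rfl
      exact hodd ⟨0, by simp⟩
    have hmk : ∀ κ : ℝ → ℝ, (∀ s, 0 < s →
        |s * Real.sin (Real.pi * β) + Real.sin (Real.pi * (β - α))| / (1 + s) ^ 2 ≤ κ s) →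
        PoleKernel (popovKernel α β) κ ∅ ((1 + Real.cos (Real.pi * α)) / 2)⁻¹ := fun κ h =>
      poleKernel_of_abs_le (measurable_popovKernel α β) hK fun s hs =>
        (hb s hs).trans (mul_le_mul_of_nonneg_left (h s hs) hK)
    rcases eq_or_ne α β with hαβ | hαβ
    · refine ⟨fun s => s / (1 + s) ^ 2, ∅, _, hmk _ fun s hs => ?_, fun _ => rfl, by fun_prop,
        fun s hs => ?_, fun s hs => ?_, fun h => absurd h (hne hαβ)⟩
      · gcongr
        rw [hαβ, sub_self, mul_zero, Real.sin_zero, add_zero, abs_mul, abs_of_pos hs]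
        exact mul_le_of_le_one_right hs.le (Real.abs_sin_le_one _)
      · rw [if_pos hαβ, Real.rpow_one, abs_of_pos (by positivity)]
        exact div_le_self hs.le (by nlinarith)
      · rw [abs_of_pos (by positivity), div_le_div_iff₀ (by positivity) (by positivity)]
        nlinarith
    · have hsq : ∀ s : ℝ, 0 < s → 1 / (1 + s) ^ 2 ≤ 1 / (1 + s) := fun s hs =>
        one_div_le_one_div_of_le (by linarith) (by nlinarith)
      have hone : ∀ s : ℝ, 0 < s → 1 / (1 + s) ≤ s ^ (if α = β then 1 else 0 : ℝ) :=
        fun s hs => by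
          rw [if_neg hαβ, Real.rpow_zero]
          exact (div_le_one (by linarith)).2 (by linarith)
      rcases eq_or_ne β 1 with h1 | h1
      · refine ⟨fun s => 1 / (1 + s) ^ 2, ∅, _, hmk _ fun s hs => ?_, fun _ => rfl, by fun_prop,
          fun s hs => ?_, fun s hs => ?_, fun _ s hs => ?_⟩
        · gcongr
          rw [h1, mul_one, Real.sin_pi, mul_zero, zero_add]
          exact Real.abs_sin_le_one _
        all_goals rw [abs_of_pos (by positivity)]
        · exact (hsq s hs).trans (hone s hs)
        · exact hsq s hs
      · refine ⟨fun s => 1 / (1 + s), ∅, _, hmk _ fun s hs => ?_, fun _ => rfl, by fun_prop,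
          fun s hs => ?_, fun s hs => ?_, fun h => absurd h h1⟩
        · rw [div_le_div_iff₀ (by positivity) (by positivity)]
          have : |s * Real.sin (Real.pi * β) + Real.sin (Real.pi * (β - α))| ≤ s + 1 := by
            refine (abs_add_le _ _).trans (add_le_add ?_ (Real.abs_sin_le_one _))
            rw [abs_mul, abs_of_pos hs]
            exact mul_le_of_le_one_right hs.le (Real.abs_sin_le_one _)
          nlinarith
        all_goals rw [abs_of_pos (by positivity)]
        exact hone s hs

/-! ### Rescaling the integral by |z| -/

theorem preimage_mul_left_puncturedRay {x : ℝ} (hx : 0 < x) (ε : ℝ) :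
    (fun s => x * s) ⁻¹' puncturedRay x ε = puncturedRay 1 (ε / x) := by
  ext s
  simp only [puncturedRay, mem_preimage, mem_ofPred_eq]
  rw [show x * s - x = x * (s - 1) by ring, abs_mul, abs_of_pos hx, div_lt_iff₀' hx,
    mul_pos_iff_of_pos_left hx]

theorem indicator_comp_mul_left (S : Set ℝ) (f : ℝ → ℂ) (x s : ℝ) :
    S.indicator f (x * s) = ((fun s => x * s) ⁻¹' S).indicator (fun s => f (x * s)) s := rfl

theorem integrableOn_iff_comp_mul_left {x : ℝ} (hx : 0 < x) {S : Set ℝ} (hS : MeasurableSet S)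
    (f : ℝ → ℂ) :
    IntegrableOn f S ↔ IntegrableOn (fun s => f (x * s)) ((fun s => x * s) ⁻¹' S) := by
  rw [← integrable_indicator_iff hS,
    ← integrable_indicator_iff (measurable_const_mul x hS),
    ← integrable_comp_mul_left_iff _ hx.ne']
  rfl

theorem setIntegral_eq_comp_mul_left {x : ℝ} (hx : 0 < x) {S : Set ℝ} (hS : MeasurableSet S)
    (f : ℝ → ℂ) : ∫ τ in S, f τ = x • ∫ s in (fun s => x * s) ⁻¹' S, f (x * s) := by
  rw [← integral_indicator hS, ← integral_indicator (measurable_const_mul x hS)]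
  have := Measure.integral_comp_mul_left (S.indicator f) x
  simp_rw [indicator_comp_mul_left] at this
  rw [this, abs_of_pos (inv_pos.2 hx), smul_smul, mul_inv_cancel₀ hx.ne', one_smul]

/-- The rational factor is homogeneous of degree -1 in (τ, z); the resulting x⁻¹ cancels against dτ
= x ds. -/
theorem popovIntegrand_dilate (α β : ℝ) {x : ℝ} (hx : 0 < x) (s : ℝ) :
    popovIntegrand α β ((-x : ℝ) : ℂ) (x * s) =
      ((x⁻¹ * (eulerIterate α ((1 - β) / α) 0 0 (x * s) * popovKernel α β s) : ℝ) : ℂ) := by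
  have h : ((x * s) * Real.sin (Real.pi * β) - (-x) * Real.sin (Real.pi * (β - α))) /
      ((x * s) ^ 2 - 2 * (x * s) * (-x) * Real.cos (Real.pi * α) + (-x) ^ 2) =
      x⁻¹ * popovKernel α β s := by
    rw [popovKernel, ← one_div, div_mul_div_comm, one_mul,
      ← mul_div_mul_left _ (x * _) hx.ne']
    congr 1 <;> ring
  simp only [popovIntegrand, eulerIterate, Nat.cast_zero, zero_div, add_zero]
  rw [mul_left_comm, ← h]
  push_cast
  rfl

section Popov

variable {α β : ℝ} {κ : ℝ → ℝ} {N : Set ℝ} {K : ℝ}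

theorem integrableOn_popovIntegrand_puncturedRay (hα : 0 < α) (hβ : β < 1 + α)
    (hq : PoleKernel (popovKernel α β) κ N K)
    (hκ : ∀ x, 0 < x →
      IntegrableOn (fun s => decayWeight ((1 - β) / α) (x * s) * |κ s|) (Ioi 0))
    {x ε : ℝ} (hx : 0 < x) (hε : 0 < ε) :
    IntegrableOn (popovIntegrand α β ((-x : ℝ) : ℂ)) (puncturedRay x ε) := by
  have ha := neg_one_lt_exponent hα hβ
  rw [integrableOn_iff_comp_mul_left hx (measurableSet_puncturedRay x ε),
    preimage_mul_left_puncturedRay hx]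
  simp_rw [popovIntegrand_dilate α β hx]
  exact (((eulerFamily_eulerIterate hα ha).integrableOn_puncturedRay ha hq hκ 0 hx
    (div_pos hε hx)).const_mul _).ofReal

theorem integrableOn_popovIntegrand_Ioi (hα : 0 < α) (hβ : β < 1 + α)
    (hq : PoleKernel (popovKernel α β) κ ∅ K)
    (hκ : ∀ x, 0 < x →
      IntegrableOn (fun s => decayWeight ((1 - β) / α) (x * s) * |κ s|) (Ioi 0))
    {x : ℝ} (hx : 0 < x) :
    IntegrableOn (popovIntegrand α β ((-x : ℝ) : ℂ)) (Ioi 0) := by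
  have ha := neg_one_lt_exponent hα hβ
  have hpre : (fun s => x * s) ⁻¹' Ioi 0 = Ioi 0 := by
    ext s; simp [mul_pos_iff_of_pos_left hx]
  rw [integrableOn_iff_comp_mul_left hx measurableSet_Ioi, hpre]
  simp_rw [popovIntegrand_dilate α β hx]
  have h := (eulerFamily_eulerIterate hα ha).integrableOn_regularized ha hq hκ 0 hx
  unfold regularized at h
  simp only [indicator_empty, mul_zero, sub_zero] at h
  exact (h.const_mul _).ofReal

theorem tendsto_integral_popovIntegrand (hα : 0 < α) (hβ : β < 1 + α)
    (hq : PoleKernel (popovKernel α β) κ N K)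
    (hκ : ∀ x, 0 < x →
      IntegrableOn (fun s => decayWeight ((1 - β) / α) (x * s) * |κ s|) (Ioi 0))
    {x : ℝ} (hx : 0 < x) :
    Tendsto (fun ε => ∫ τ in puncturedRay x ε, popovIntegrand α β ((-x : ℝ) : ℂ) τ) (𝓝[>] 0)
      (𝓝 ((∫ s in Ioi (0 : ℝ), regularized (popovKernel α β) N
        (eulerIterate α ((1 - β) / α) 0 0) x s : ℝ) : ℂ)) := by
  have ha := neg_one_lt_exponent hα hβ
  have h := (eulerFamily_eulerIterate hα ha).tendsto_integral_puncturedRay ha hq hκ 0 hx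
  have hdiv : Tendsto (fun ε : ℝ => ε / x) (𝓝[>] 0) (𝓝[>] 0) := by
    refine tendsto_nhdsWithin_iff.2 ⟨?_, ?_⟩
    · have : Tendsto (fun ε : ℝ => ε / x) (𝓝 0) (𝓝 (0 / x)) := tendsto_id.div_const x
      rw [zero_div] at this
      exact this.mono_left nhdsWithin_le_nhds
    · filter_upwards [self_mem_nhdsWithin] with ε hε using div_pos hε hx
  refine ((Complex.continuous_ofReal.tendsto _).comp (h.comp hdiv)).congr fun ε => ?_
  rw [setIntegral_eq_comp_mul_left hx (measurableSet_puncturedRay x ε),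
    preimage_mul_left_puncturedRay hx]
  simp_rw [popovIntegrand_dilate α β hx]
  rw [integral_complex_ofReal, integral_const_mul, Complex.real_smul, ← Complex.ofReal_mul,
    mul_inv_cancel_left₀ hx.ne']
  rfl

theorem popovF_neg (hα : 0 < α) (hβ : β < 1 + α)
    (hq : PoleKernel (popovKernel α β) κ N K)
    (hκ : ∀ x, 0 < x →
      IntegrableOn (fun s => decayWeight ((1 - β) / α) (x * s) * |κ s|) (Ioi 0))
    {x : ℝ} (hx : 0 < x) :
    popovF α β ((-x : ℝ) : ℂ) = ((1 / (Real.pi * α) : ℝ) : ℂ) *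
      ((∫ s in Ioi (0 : ℝ), regularized (popovKernel α β) N
        (eulerIterate α ((1 - β) / α) 0 0) x s : ℝ) : ℂ) := by
  have hn : ‖((-x : ℝ) : ℂ)‖ = x := by
    rw [Complex.norm_real, norm_neg, Real.norm_of_nonneg hx.le]
  rw [popovF, hn, principalValue, (tendsto_integral_popovIntegrand hα hβ hq hκ hx).limUnder_eq]

end Popov

/-! ### The main theorem -/

theorem lemmaA2 (α β : ℝ) (hα : 0 < α) (hβ : β < 1 + α) :
    -- the defining integral converges at every `z < 0`, absolutely unless `α` is an odd integer
    (∀ z : ℝ, z < 0 →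
      (∀ ε : ℝ, 0 < ε → IntegrableOn (popovIntegrand α β (z : ℂ)) (puncturedRay |z| ε)) ∧
      Tendsto (fun ε : ℝ => ((1 / (Real.pi * α) : ℝ) : ℂ) *
          ∫ τ in puncturedRay |z| ε, popovIntegrand α β (z : ℂ) τ)
        (𝓝[>] (0 : ℝ)) (𝓝 (popovF α β (z : ℂ))) ∧
      ((¬ ∃ m : ℤ, α = 2 * (m : ℝ) + 1) →
        IntegrableOn (popovIntegrand α β (z : ℂ)) (Ioi 0))) ∧
    -- `F_{α,β}` is smooth on the negative half-line
    ContDiffOn ℝ ∞ (fun x : ℝ => popovF α β (x : ℂ)) (Iio 0) ∧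
    -- the estimate
    ∀ k : ℕ, ∃ C : ℝ, 0 < C ∧ ∀ z : ℝ, z < 0 →
      ‖iteratedDeriv k (fun x : ℝ => popovF α β (x : ℂ)) z‖ ≤
        C * |z| ^ (-(max (β - 1) 0) / α - (k : ℝ)) *
          (1 + |z|) ^ ((if α = β then (-2 : ℝ) else -1) + max (β - 1) 0 / α) := by
  obtain ⟨κ, N, K, hq, hN, hκ, A, hA, hle⟩ := exists_poleKernel_popovKernel hα hβ
  have ha := neg_one_lt_exponent hα hβ
  have hG := eulerFamily_eulerIterate hα ha
  set c : ℝ := 1 / (Real.pi * α) with hc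
  set T : ℕ → ℝ → ℝ := fun k x => ∫ s in Ioi (0 : ℝ), regularized (popovKernel α β) N
    (eulerIterate α ((1 - β) / α) k 0) x s with hT
  have hF : EqOn (fun x : ℝ => popovF α β (x : ℂ)) (fun z => (c : ℂ) * ((T 0 (-z) : ℝ) : ℂ))
      (Iio 0) := fun z hz => by
    have := popovF_neg hα hβ hq hκ (neg_pos.2 hz)
    rwa [neg_neg] at this
  have hderiv : ∀ j z, z < 0 → HasDerivAt (fun z => (c : ℂ) * ((T j (-z) : ℝ) : ℂ))
      (z⁻¹ • ((c : ℂ) * ((T (j + 1) (-z) : ℝ) : ℂ))) z := fun j z hz => by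
    have h1 := (hG.hasDerivAt_integral_regularized ha hq hκ j (neg_pos.2 hz)).comp z
      (hasDerivAt_neg z)
    -- The sign from the inner function -z turns (-z)⁻¹ into z⁻¹.
    refine (h1.ofReal_comp.const_mul (c : ℂ)).congr_deriv ?_
    simp only [hT, inv_neg, Complex.real_smul]
    push_cast
    ring
  have hmod : ∀ z, z < 0 → 0 ≤ popovModulus α β |z| := fun z hz => by
    unfold popovModulus; positivity
  have hbound : ∀ j, ∃ C, 0 ≤ C ∧ ∀ z, z < 0 →
      ‖(c : ℂ) * ((T j (-z) : ℝ) : ℂ)‖ ≤ C * popovModulus α β |z| := fun j => by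
    obtain ⟨B, hB, h⟩ := hG.abs_integral_regularized_le ha hq hκ j
    -- A bounds the integral against κ, and 1 the contribution of N.
    refine ⟨|c| * (B * (A + 1)), by positivity, fun z hz => ?_⟩
    have hz' := neg_pos.2 hz
    rw [norm_mul, Complex.norm_real, Complex.norm_real, Real.norm_eq_abs, Real.norm_eq_abs,
      abs_of_neg hz, mul_assoc, mul_assoc]
    gcongr
    refine (h _ hz').trans ?_
    gcongr
    linarith [hle _ hz', decayWeight_le_popovModulus (β := β) hα hz']
  refine ⟨fun z hz => ?_, ?_, fun k => ?_⟩
  · obtain ⟨x, rfl⟩ : ∃ x, z = -x := ⟨-z, by ring⟩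
    have hx : 0 < x := by linarith
    rw [abs_of_neg hz, neg_neg]
    refine ⟨fun ε hε => integrableOn_popovIntegrand_puncturedRay hα hβ hq hκ hx hε, ?_, fun h => ?_⟩
    · rw [popovF_neg hα hβ hq hκ hx]
      exact (tendsto_integral_popovIntegrand hα hβ hq hκ hx).const_mul _
    · obtain rfl := hN h
      exact integrableOn_popovIntegrand_Ioi hα hβ hq hκ hx
  · exact (contDiffOn_of_eulerSequence hderiv 0).congr hF
  · obtain ⟨C, hC, h⟩ := norm_iteratedDeriv_le_of_eulerSequence hmod hderiv hbound k
    refine ⟨C, hC, fun z hz => ?_⟩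
    have he := (hF.eventuallyEq_of_mem (Iio_mem_nhds hz)).iteratedDeriv_eq k
    rw [he]
    refine (h z hz).trans_eq ?_
    rw [popovModulus, sub_eq_add_neg _ (k : ℝ), Real.rpow_add (abs_pos.2 hz.ne)]
    ring
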